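/- **Probabilistic zero forcing.** Let $G$ be a finite graph and $Z\subseteq V(G)$ a set of initially blue vertices; all other vertices are white. In each round, with $B$ the current set of blue vertices, every blue vertex $u$ attempts to force each of its white neighbors $w$, all attempts being independent, and each attempt succeeds with probability $$\frac{|N[u]\cap B|}{\deg(u)},$$ where $N[u]$ is the closed neighborhood of $u$. A white vertex becomes blue at the end of the round if at least one attempt to force it succeeds, and blue vertices stay blue. The propagation time $pt_{pzf}(G,v)$ is the (random) first number $t\ge 0$ of rounds after which all vertices are blue when the process starts from $Z=\{v\}$ ($\infty$ if this never happens). The propagation time of the graph is $pt_{pzf}(G)=\min_{v\in V(G)}pt_{pzf}(G,v)$, where the $|V(G)|$ runs of the process, one for each starting vertex $v$, are performed independently on the same graph $G$. Let $\mathcal G(n,p)$ be the binomial random graph on $n$ labelled vertices, in which each pair of vertices is an edge independently with probability $p$. Probabilities below are over both the random graph and the forcing process on it. **Theorem.** Let $p=p(n)\in[0,1]$ satisfy $p(n)\ge 1/\log^2 n$ for all sufficiently large $n$ (natural logarithm). Then there is a sequence $\delta(n)\to 0$ such that: 1. for every vertex $v$ of $\mathcal G(n,p)$, with probability $1-o(n^{-1})$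 (where the $o(n^{-1})$ is uniform in $v$), $$pt_{pzf}(\mathcal G(n,p),v)\ \ge\ (1+\delta(n))\log_2\log_2 n;$$ 2. with probability tending to $1$ as $n\to\infty$, $$pt_{pzf}(\mathcal G(n,p))\ =\ \min_{v}\,pt_{pzf}(\mathcal G(n,p),v)\ \ge\ (1+\delta(n))\log_2\log_2 n.$$ -/

import Mathlib

open MeasureTheory ProbabilityTheory Filter Topology

namespace ProbZeroForcing

/-- The probability `|N[u] ∩ Z| / deg(u)` with which a blue vertex `u` forces any given one of its
white neighbors in a single round, when `Z` is the current set of blue vertices. (On a finite graph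
it is at most `1` as soon as `u` has a white neighbor.) -/
noncomputable def forceProb {V : Type*} (G : SimpleGraph V) (Z : Set V) (u : V) : ℝ :=
  ((insert u (G.neighborSet u) ∩ Z).ncard : ℝ) / ((G.neighborSet u).ncard : ℝ)

/-- The blue set after one round played from the blue set `Z`. The number `U (u, w) ∈ [0,1]` is the
randomness of the attempt of `u` to force `w`: a blue vertex `u` forces its white neighbor `w` if
and only if `U (u, w) ≤ |N[u] ∩ Z| / deg(u)`. -/
def step {V : Type*} (G : SimpleGraph V) (Z : Set V) (U : V × V → unitInterval) : Set V :=
  Z ∪ {w | ∃ u ∈ Z, G.Adj u w ∧ (U (u, w) : ℝ) ≤ forceProb G Z u}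

/-- The set of blue vertices after `t` rounds, starting from the blue set `Z`; round `t + 1` uses
the numbers `U t`. -/
def blue {V : Type*} (G : SimpleGraph V) (Z : Set V) (U : ℕ → V × V → unitInterval) : ℕ → Set V
  | 0 => Z
  | t + 1 => step G (blue G Z U t) (U t)

/-- The propagation time: the first round after which every vertex is blue (`⊤` if there is no such
round). -/
noncomputable def propTime {V : Type*} (G : SimpleGraph V) (Z : Set V)
    (U : ℕ → V × V → unitInterval) : ℕ∞ :=
  ⨅ (t : ℕ) (_ : blue G Z U t = Set.univ), (t : ℕ∞)

/-- The propagation time of the graph: the minimum, over all vertices `v`, of the propagation times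
of the runs started from `{v}`, where the run started from `{v}` uses its own numbers `W v`. -/
noncomputable def graphPropTime {V : Type*} (G : SimpleGraph V)
    (W : V → ℕ → V × V → unitInterval) : ℕ∞ :=
  ⨅ v : V, propTime G {v} (W v)

/-- The law of the randomness of one run: independent uniform numbers in `[0,1]`, one for each round
and each ordered pair of vertices. -/
noncomputable def runMeasure (V : Type*) [Fintype V] : Measure (ℕ → V × V → unitInterval) :=
  Measure.infinitePi fun _ : ℕ => Measure.pi fun _ : V × V => (volume : Measure unitInterval)

/-- The law of the random graph `G(n,p)` together with an independent run: first the graph is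
drawn, then probabilistic zero forcing is run once on it. -/
noncomputable def oneRunMeasure (n : ℕ) (p : unitInterval) :
    Measure (SimpleGraph (Fin n) × (ℕ → Fin n × Fin n → unitInterval)) :=
  (SimpleGraph.binomialRandom (Fin n) p).prod (runMeasure (Fin n))

/-- The law of the random graph `G(n,p)` together with `n` mutually independent runs on that graph,
one for each vertex. -/
noncomputable def allRunsMeasure (n : ℕ) (p : unitInterval) :
    Measure (SimpleGraph (Fin n) × (Fin n → ℕ → Fin n × Fin n → unitInterval)) :=
  (SimpleGraph.binomialRandom (Fin n) p).prod (Measure.pi fun _ : Fin n => runMeasure (Fin n))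

end ProbZeroForcing

/-!
Let `B` be the blue set. A blue vertex `u` makes at most `deg u` attempts in a round, each
succeeding with probability at most `|N[u] ∩ B| / deg u`, so on average at most `|B|` of them
succeed; hence a round has at most `|B|²` successes on average, whatever the graph. By a Chernoff
bound the round leaves fewer than `|B| + 2|B|² + s` vertices blue, except with probability
`exp (-s)`: the number of blue vertices is essentially at most squared. With `s = 3 log n`, after
`t` rounds there are at most `(12 log n) ^ 2 ^ t / 4` of them, which is less than `n` as long as
`t ≤ log₂ log₂ n - √(log₂ log₂ n)`. The total failure probability `t n⁻³` is at most `n⁻²` for one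
starting vertex, which leaves room for a union bound over all of them.
-/

namespace ProbZeroForcing

theorem measureReal_prod_le_of_forall_section_le {α β : Type*} [Countable α] [MeasurableSpace α]
    [MeasurableSingletonClass α] [MeasurableSpace β] {μ : Measure α} [IsProbabilityMeasure μ]
    {ν : Measure β} [IsFiniteMeasure ν] {S : Set (α × β)} {c : ℝ}
    (h : ∀ a, ν.real (Prod.mk a ⁻¹' S) ≤ c) : (μ.prod ν).real S ≤ c := by
  have hc : 0 ≤ c :=
    (nonempty_of_isProbabilityMeasure μ).elim fun a => measureReal_nonneg.trans (h a)
  have hS : S ⊆ ⋃ a, {a} ×ˢ (Prod.mk a ⁻¹' S) := fun x hx => by simpa using hx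
  refine ENNReal.toReal_le_of_le_ofReal hc ?_
  calc μ.prod ν S
      ≤ ∑' a, μ.prod ν ({a} ×ˢ (Prod.mk a ⁻¹' S)) := (measure_mono hS).trans (measure_iUnion_le _)
    _ ≤ ∑' a, ENNReal.ofReal c * μ {a} := by
        gcongr with a
        rw [Measure.prod_prod, mul_comm]
        gcongr
        exact (ENNReal.le_ofReal_iff_toReal_le (measure_ne_top _ _) hc).2 (h a)
    _ = ∫⁻ _, ENNReal.ofReal c ∂μ := (lintegral_countable' _).symm
    _ = ENNReal.ofReal c := by simp

theorem mgf_indicator_one_le {Ω : Type*} [MeasurableSpace Ω] {μ : Measure Ω}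
    [IsProbabilityMeasure μ] {A : Set Ω} (hA : MeasurableSet A) (t : ℝ) :
    mgf (A.indicator 1) μ t ≤ Real.exp ((Real.exp t - 1) * μ.real A) := by
  have hexp : (fun ω => Real.exp (t * A.indicator 1 ω)) =
      fun ω => 1 + A.indicator (fun _ => Real.exp t - 1) ω := by
    ext ω
    by_cases hω : ω ∈ A <;> simp [hω]
  calc mgf (A.indicator 1) μ t = 1 + (Real.exp t - 1) * μ.real A := by
        rw [mgf, hexp, integral_add (integrable_const _) ((integrable_const _).indicator hA),
          integral_indicator_const _ hA]
        simp [mul_comm]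
    _ ≤ _ := by linarith [Real.add_one_le_exp ((Real.exp t - 1) * μ.real A)]

theorem measureReal_le_ncard_le_exp {Ω ι : Type*} [MeasurableSpace Ω] [Fintype ι] {μ : Measure Ω}
    {A : ι → Set Ω} (hind : iIndepSet A μ) (hA : ∀ i, MeasurableSet (A i)) {t : ℝ} (ht : 0 ≤ t)
    (a : ℝ) :
    μ.real {ω | a ≤ ({i | ω ∈ A i}.ncard : ℝ)} ≤
      Real.exp ((Real.exp t - 1) * ∑ i, μ.real (A i) - t * a) := by
  have := hind.isProbabilityMeasure
  let X : ι → Ω → ℝ := fun i => (A i).indicator 1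
  have hX (i : ι) : Measurable (X i) := measurable_one.indicator (hA i)
  have hcount (ω : Ω) : ({i | ω ∈ A i}.ncard : ℝ) = (∑ i, X i) ω := by
    classical
    simp [X, Set.indicator_apply, Set.ncard_eq_toFinset_card']
  have hint : Integrable (fun ω => Real.exp (t * (∑ i, X i) ω)) μ :=
    integrable_exp_mul_of_le t (Fintype.card ι : ℝ) ht (by fun_prop) (ae_of_all _ fun ω => by
      rw [← hcount]
      exact_mod_cast (Set.ncard_le_card _).trans_eq Nat.card_eq_fintype_card)
  simp_rw [hcount]
  calc μ.real {ω | a ≤ (∑ i, X i) ω}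
      ≤ Real.exp (-t * a) * mgf (∑ i, X i) μ t := measure_ge_le_exp_mul_mgf a ht hint
    _ = Real.exp (-t * a) * ∏ i, mgf (X i) μ t := by
        rw [iIndepFun.mgf_sum (X := X) hind.iIndepFun_indicator hX]
    _ ≤ Real.exp (-t * a) * ∏ i, Real.exp ((Real.exp t - 1) * μ.real (A i)) := by
        gcongr with i
        · exact fun i _ => mgf_nonneg
        · exact mgf_indicator_one_le (hA i) t
    _ = _ := by
        rw [← Real.exp_sum, ← Real.exp_add, ← Finset.mul_sum]
        ring_nf

theorem iIndepSet_pi {ι : Type*} [Fintype ι] {Ω : ι → Type*} [∀ i, MeasurableSpace (Ω i)]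
    {μ : ∀ i, Measure (Ω i)} [∀ i, IsProbabilityMeasure (μ i)] {A : ∀ i, Set (Ω i)}
    (hA : ∀ i, MeasurableSet (A i)) :
    iIndepSet (fun i => Function.eval i ⁻¹' A i) (Measure.pi μ) :=
  (iIndepSet_iff_meas_biInter fun i => measurable_pi_apply i (hA i)).2 fun s =>
    (iIndepFun_pi fun _ => aemeasurable_id).measure_inter_preimage_eq_mul s fun i _ => hA i

theorem measureReal_pi_le_ncard_le_exp {ι : Type*} [Fintype ι] {Ω : ι → Type*}
    [∀ i, MeasurableSpace (Ω i)] {μ : ∀ i, Measure (Ω i)} [∀ i, IsProbabilityMeasure (μ i)]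
    {A : ∀ i, Set (Ω i)} (hA : ∀ i, MeasurableSet (A i)) {t : ℝ} (ht : 0 ≤ t) (a : ℝ) :
    (Measure.pi μ).real {x | a ≤ ({i | x i ∈ A i}.ncard : ℝ)} ≤
      Real.exp ((Real.exp t - 1) * ∑ i, (μ i).real (A i) - t * a) := by
  have hmarginal (i : ι) : (Measure.pi μ).real (Function.eval i ⁻¹' A i) = (μ i).real (A i) :=
    (measurePreserving_eval μ i).measureReal_preimage (hA i).nullMeasurableSet
  simp_rw [← hmarginal]
  exact measureReal_le_ncard_le_exp (iIndepSet_pi hA) (fun i => measurable_pi_apply i (hA i)) ht a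

theorem volume_real_setOf_coe_le_le {c : ℝ} (hc : 0 ≤ c) :
    (volume : Measure unitInterval).real {x | (x : ℝ) ≤ c} ≤ c := by
  rcases le_total 1 c with h | h
  · exact measureReal_le_one.trans h
  · have hIic : {x : unitInterval | (x : ℝ) ≤ c} = Set.Iic ⟨c, hc, h⟩ := rfl
    rw [hIic, measureReal_def, unitInterval.volume_Iic, ENNReal.toReal_ofReal hc]

variable {V : Type*}

theorem forceProb_nonneg (G : SimpleGraph V) (Z : Set V) (u : V) : 0 ≤ forceProb G Z u := by
  unfold forceProb
  positivity

theorem ncard_neighborSet_mul_forceProb_le [Finite V] (G : SimpleGraph V) (Z : Set V) (u : V) :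
    ((G.neighborSet u).ncard : ℝ) * forceProb G Z u ≤ Z.ncard := by
  have h : ((insert u (G.neighborSet u) ∩ Z).ncard : ℝ) ≤ Z.ncard := by
    exact_mod_cast Set.ncard_le_ncard Set.inter_subset_right
  rw [forceProb, ← mul_div_assoc]
  exact div_le_of_le_mul₀ (by positivity) (by positivity) (by rw [mul_comm]; gcongr)

/-- The values of the random number `U e` for which `e.1` is blue and succeeds in forcing its
neighbor `e.2`, when the blue set is `Z`. Attempts on vertices that are already blue are counted
too, which does no harm in upper bounds. -/
def forcingSet (G : SimpleGraph V) (Z : Set V) (e : V × V) : Set unitInterval :=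
  {x | (e.1 ∈ Z ∧ G.Adj e.1 e.2) ∧ (x : ℝ) ≤ forceProb G Z e.1}

theorem measurableSet_forcingSet (G : SimpleGraph V) (Z : Set V) (e : V × V) :
    MeasurableSet (forcingSet G Z e) :=
  (MeasurableSet.const _).inter (measurableSet_le measurable_subtype_coe measurable_const)

theorem volume_real_forcingSet_le (G : SimpleGraph V) (Z : Set V) (e : V × V)
    [Decidable (e.1 ∈ Z ∧ G.Adj e.1 e.2)] :
    (volume : Measure unitInterval).real (forcingSet G Z e) ≤
      if e.1 ∈ Z ∧ G.Adj e.1 e.2 then forceProb G Z e.1 else 0 := by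
  split_ifs with he
  · exact (measureReal_mono fun _ hx => hx.2).trans
      (volume_real_setOf_coe_le_le (forceProb_nonneg G Z e.1))
  · simp [forcingSet, he]

theorem sum_volume_real_forcingSet_le [Fintype V] (G : SimpleGraph V) (Z : Set V) :
    ∑ e, (volume : Measure unitInterval).real (forcingSet G Z e) ≤ (Z.ncard : ℝ) ^ 2 := by
  classical
  calc ∑ e, (volume : Measure unitInterval).real (forcingSet G Z e)
      ≤ ∑ u, ∑ w, if u ∈ Z ∧ G.Adj u w then forceProb G Z u else 0 := by
        rw [Fintype.sum_prod_type]
        gcongr with u _ w _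
        exact volume_real_forcingSet_le G Z (u, w)
    _ = ∑ u with u ∈ Z, (G.neighborSet u).ncard * forceProb G Z u := by
        simp [ite_and, Finset.sum_ite, Set.ncard_eq_toFinset_card']
    _ ≤ ∑ u with u ∈ Z, (Z.ncard : ℝ) := by
        gcongr with u
        exact ncard_neighborSet_mul_forceProb_le G Z u
    _ = (Z.ncard : ℝ) ^ 2 := by
        simp [Set.ncard_eq_toFinset_card', sq]

theorem ncard_step_le [Finite V] (G : SimpleGraph V) (Z : Set V) (U : V × V → unitInterval) :
    (step G Z U).ncard ≤ Z.ncard + {e | U e ∈ forcingSet G Z e}.ncard := by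
  have hsub : step G Z U ⊆ Z ∪ Prod.snd '' {e | U e ∈ forcingSet G Z e} := by
    rintro w (hw | ⟨u, hu, huw, hU⟩)
    · exact .inl hw
    · exact .inr ⟨(u, w), ⟨⟨hu, huw⟩, hU⟩, rfl⟩
  calc (step G Z U).ncard
      ≤ Z.ncard + (Prod.snd '' {e | U e ∈ forcingSet G Z e}).ncard :=
        (Set.ncard_le_ncard hsub).trans (Set.ncard_union_le _ _)
    _ ≤ _ := by gcongr; exact Set.ncard_image_le

/-- The law of the randomness of one round. -/
noncomputable abbrev roundMeasure (V : Type*) [Fintype V] : Measure (V × V → unitInterval) :=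
  Measure.pi fun _ : V × V => (volume : Measure unitInterval)

theorem roundMeasure_real_le_ncard_step_le [Fintype V] (G : SimpleGraph V) (Z : Set V) (s : ℝ) :
    (roundMeasure V).real {U | Z.ncard + 2 * (Z.ncard : ℝ) ^ 2 + s ≤ (step G Z U).ncard} ≤
      Real.exp (-s) := by
  let μ : ℝ := ∑ e, (volume : Measure unitInterval).real (forcingSet G Z e)
  have hmean : (Real.exp 1 - 1) * μ ≤ 2 * (Z.ncard : ℝ) ^ 2 :=
    mul_le_mul (by linarith [Real.exp_one_lt_three]) (sum_volume_real_forcingSet_le G Z)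
      (Finset.sum_nonneg fun _ _ => measureReal_nonneg) zero_le_two
  calc (roundMeasure V).real {U | Z.ncard + 2 * (Z.ncard : ℝ) ^ 2 + s ≤ (step G Z U).ncard}
      ≤ (roundMeasure V).real
          {U | 2 * (Z.ncard : ℝ) ^ 2 + s ≤ ({e | U e ∈ forcingSet G Z e}.ncard : ℝ)} := by
        refine measureReal_mono fun U hU => ?_
        have hstep : ((step G Z U).ncard : ℝ) ≤ Z.ncard + {e | U e ∈ forcingSet G Z e}.ncard := by
          exact_mod_cast ncard_step_le G Z U
        rw [Set.mem_ofPred_eq] at hU ⊢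
        linarith
    _ ≤ Real.exp ((Real.exp 1 - 1) * μ - 1 * (2 * (Z.ncard : ℝ) ^ 2 + s)) :=
        measureReal_pi_le_ncard_le_exp (measurableSet_forcingSet G Z) zero_le_one _
    _ ≤ Real.exp (-s) := Real.exp_le_exp.2 (by linarith)

theorem measurable_step [Finite V] (G : SimpleGraph V) :
    Measurable fun x : Set V × (V × V → unitInterval) => step G x.1 x.2 := by
  refine measurable_set_iff.2 fun w => ?_
  simp only [step, Set.mem_union, Set.mem_ofPred_eq]
  have hforce (u : V) : Measurable fun x : Set V × (V × V → unitInterval) =>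
      (x.2 (u, w) : ℝ) ≤ forceProb G x.1 u :=
    measurableSet_setOfPred.1 (measurableSet_le (by fun_prop)
      ((Measurable.of_discrete (f := fun Z => forceProb G Z u)).comp measurable_fst))
  exact .or (by fun_prop)
    (.exists fun u => .and (by fun_prop) (.and measurable_const (hforce u)))

theorem measurable_blue [Finite V] {Ω : Type*} [MeasurableSpace Ω] (G : SimpleGraph V) (Z : Set V)
    {X : ℕ → Ω → V × V → unitInterval} {t : ℕ} (hX : ∀ i < t, Measurable (X i)) :
    Measurable fun ω => blue G Z (fun i => X i ω) t := by
  induction t with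
  | zero => exact measurable_const
  | succ t ih =>
    exact (measurable_step G).comp
      ((ih fun i hi => hX i (hi.trans t.lt_succ_self)).prodMk (hX t t.lt_succ_self))

instance [Fintype V] : IsProbabilityMeasure (runMeasure V) := by
  unfold runMeasure
  infer_instance

theorem indepFun_blue [Fintype V] (G : SimpleGraph V) (Z : Set V) (t : ℕ) :
    IndepFun (fun U => blue G Z U t) (fun U => U t) (runMeasure V) := by
  have hind : iIndepFun (fun i (U : ℕ → V × V → unitInterval) => U i) (runMeasure V) :=
    iIndepFun_infinitePi (X := fun _ ω => ω) fun _ => measurable_id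
  have hdisj : Disjoint (Set.Iio t) {t} := by simp
  have := indep_iSup_of_disjoint (fun i => (measurable_pi_apply i).comap_le) hind.iIndep hdisj
  rw [IndepFun_iff_Indep]
  refine indep_of_indep_of_le_left (indep_of_indep_of_le_right this (by simp)) ?_
  -- the blue set at time `t` is measurable with respect to the first `t` rounds
  refine (@measurable_blue V _ _ (_) G Z (fun i (U : ℕ → V × V → unitInterval) => U i) t
    fun i hi => ?_).comap_le
  exact (comap_measurable _).mono (le_iSup₂_of_le i hi le_rfl) le_rfl

theorem runMeasure_real_round_mem_blue_le [Fintype V] (G : SimpleGraph V) (Z : Set V) (t : ℕ)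
    {D : Set V → Set (V × V → unitInterval)} {c : ℝ} (h : ∀ Y, (roundMeasure V).real (D Y) ≤ c) :
    (runMeasure V).real {U | U t ∈ D (blue G Z U t)} ≤ c := by
  have hblue : Measurable fun U : ℕ → V × V → unitInterval => blue G Z U t :=
    measurable_blue G Z fun i _ => measurable_pi_apply i
  have hround : Measurable fun U : ℕ → V × V → unitInterval => U t := measurable_pi_apply t
  have := Measure.isProbabilityMeasure_map (μ := runMeasure V) hblue.aemeasurable
  have hlaw : (runMeasure V).map (fun U => U t) = roundMeasure V :=
    (measurePreserving_eval_infinitePi (fun _ : ℕ => roundMeasure V) t).map_eq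
  calc (runMeasure V).real {U | U t ∈ D (blue G Z U t)}
      ≤ ((runMeasure V).map fun U => (blue G Z U t, U t)).real {x | x.2 ∈ D x.1} :=
        ENNReal.toReal_mono (measure_ne_top _ _)
          (Measure.le_map_apply (hblue.prodMk hround).aemeasurable _)
    _ = (((runMeasure V).map fun U => blue G Z U t).prod (roundMeasure V)).real
          {x | x.2 ∈ D x.1} := by
        rw [(indepFun_blue G Z t).map_prod_eq_prod_map_map hblue.aemeasurable hround.aemeasurable,
          hlaw]
    _ ≤ c := measureReal_prod_le_of_forall_section_le h

theorem four_mul_add_le_sq {b s x : ℝ} (hb : 0 ≤ b) (hbx : 4 * b ≤ x) (hsx : 4 * s ≤ x)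
    (hx : 4 ≤ x) : 4 * (b + 2 * b ^ 2 + s) ≤ x ^ 2 := by
  nlinarith

theorem runMeasure_real_lt_ncard_blue_le [Fintype V] (G : SimpleGraph V) {Z : Set V} {s : ℝ}
    (hs : 1 ≤ s) (hZ : Z.ncard ≤ s) (t : ℕ) :
    (runMeasure V).real {U | (4 * s) ^ 2 ^ t < 4 * (blue G Z U t).ncard} ≤
      t * Real.exp (-s) := by
  induction t with
  | zero => simp [blue, hZ.not_gt]
  | succ t ih =>
    let D (Y : Set V) : Set (V × V → unitInterval) :=
      {U | Y.ncard + 2 * (Y.ncard : ℝ) ^ 2 + s ≤ (step G Y U).ncard}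
    have hsub : {U : ℕ → V × V → unitInterval |
        (4 * s) ^ 2 ^ (t + 1) < 4 * (blue G Z U (t + 1)).ncard} ⊆
        {U | (4 * s) ^ 2 ^ t < 4 * (blue G Z U t).ncard} ∪ {U | U t ∈ D (blue G Z U t)} := by
      intro U hU
      rw [Set.mem_union, or_iff_not_imp_left]
      intro hsmall
      simp only [Set.mem_ofPred_eq, not_lt, D] at hU hsmall ⊢
      have hbase : 4 * s ≤ (4 * s) ^ 2 ^ t := le_self_pow₀ (by linarith) (by positivity)
      have hrec := four_mul_add_le_sq (by positivity) hsmall hbase (by linarith)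
      rw [pow_succ 2 t, pow_mul] at hU
      exact le_of_mul_le_mul_left (hrec.trans hU.le) four_pos
    calc (runMeasure V).real _
        ≤ _ := (measureReal_mono hsub).trans (measureReal_union_le _ _)
      _ ≤ t * Real.exp (-s) + Real.exp (-s) :=
          add_le_add ih (runMeasure_real_round_mem_blue_le G Z t fun Y =>
            roundMeasure_real_le_ncard_step_le G Y s)
      _ = _ := by push_cast; ring

theorem monotone_blue (G : SimpleGraph V) (Z : Set V) (U : ℕ → V × V → unitInterval) :
    Monotone (blue G Z U) :=
  monotone_nat_of_le_succ fun _ => Set.subset_union_left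

theorem blue_eq_univ_of_propTime_le {G : SimpleGraph V} {Z : Set V}
    {U : ℕ → V × V → unitInterval} {t : ℕ} (h : propTime G Z U ≤ t) :
    blue G Z U t = Set.univ := by
  have hlt : propTime G Z U < ((t + 1 : ℕ) : ℕ∞) := h.trans_lt (by exact_mod_cast t.lt_succ_self)
  simp only [propTime, iInf_lt_iff, Nat.cast_lt, Nat.lt_succ_iff] at hlt
  obtain ⟨k, hk, hkt⟩ := hlt
  exact Set.univ_subset_iff.1 (hk ▸ monotone_blue G Z U hkt)

theorem exists_propTime_le_of_graphPropTime_le {G : SimpleGraph V}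
    {W : V → ℕ → V × V → unitInterval} {t : ℕ} (h : graphPropTime G W ≤ t) :
    ∃ v, propTime G {v} (W v) ≤ t := by
  have hlt : graphPropTime G W < ((t + 1 : ℕ) : ℕ∞) :=
    h.trans_lt (by exact_mod_cast t.lt_succ_self)
  obtain ⟨v, hv⟩ := iInf_lt_iff.1 hlt
  exact ⟨v, Order.lt_add_one_iff_of_not_isMax (by simp) |>.1 (by exact_mod_cast hv)⟩

theorem runMeasure_real_propTime_le_le [Fintype V] (G : SimpleGraph V) {Z : Set V} {s : ℝ}
    (hs : 1 ≤ s) (hZ : Z.ncard ≤ s) {t : ℕ} (ht : (4 * s) ^ 2 ^ t < 4 * Fintype.card V) :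
    (runMeasure V).real {U | propTime G Z U ≤ t} ≤ t * Real.exp (-s) := by
  refine (measureReal_mono fun U hU => ?_).trans (runMeasure_real_lt_ncard_blue_le G hs hZ t)
  simpa [blue_eq_univ_of_propTime_le hU, Set.ncard_univ] using ht

theorem pi_runMeasure_real_graphPropTime_le_le [Fintype V] (G : SimpleGraph V) {t : ℕ} {c : ℝ}
    (h : ∀ v, (runMeasure V).real {U | propTime G {v} U ≤ t} ≤ c) :
    (Measure.pi fun _ : V => runMeasure V).real {W | graphPropTime G W ≤ t} ≤
      Fintype.card V * c := by
  let E (v : V) : Set (ℕ → V × V → unitInterval) := {U | propTime G {v} U ≤ t}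
  have hsub : {W | graphPropTime G W ≤ t} ⊆ ⋃ v, Function.eval v ⁻¹' E v := fun W hW =>
    Set.mem_iUnion.2 (exists_propTime_le_of_graphPropTime_le hW)
  have heval (v : V) : (Measure.pi fun _ : V => runMeasure V).real (Function.eval v ⁻¹' E v) ≤
      (runMeasure V).real (E v) := by
    refine ENNReal.toReal_mono (measure_ne_top _ _) ?_
    conv_rhs => rw [← (measurePreserving_eval (fun _ : V => runMeasure V) v).map_eq]
    exact Measure.le_map_apply (measurable_pi_apply v).aemeasurable _
  calc (Measure.pi fun _ : V => runMeasure V).real {W | graphPropTime G W ≤ t}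
      ≤ ∑ v, (Measure.pi fun _ : V => runMeasure V).real (Function.eval v ⁻¹' E v) :=
        (measureReal_mono hsub).trans (measureReal_iUnion_fintype_le _)
    _ ≤ ∑ _v : V, c := by
        gcongr with v
        exact (heval v).trans (h v)
    _ = Fintype.card V * c := by simp

theorem one_sub_le_measureReal_coe_le {Ω : Type*} [MeasurableSpace Ω] {μ : Measure Ω}
    [IsProbabilityMeasure μ] {N : Ω → ℕ∞} {x c : ℝ} {t : ℕ} (hx : x ≤ t + 1)
    (h : μ.real {ω | N ω ≤ t} ≤ c) :
    1 - c ≤ μ.real {ω | (x : EReal) ≤ ((N ω : ENNReal) : EReal)} := by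
  have hcover : {ω | (x : EReal) ≤ ((N ω : ENNReal) : EReal)} ∪ {ω | N ω ≤ t} = Set.univ := by
    refine Set.eq_univ_of_forall fun ω => or_iff_not_imp_right.2 fun (hω : ¬N ω ≤ t) => ?_
    have hN : ((t + 1 : ℕ) : ℕ∞) ≤ N ω := by
      rw [Nat.cast_succ]
      exact Order.add_one_le_of_lt (not_le.1 hω)
    calc (x : EReal) ≤ ((t + 1 : ℝ) : EReal) := EReal.coe_le_coe hx
      _ = ((((t + 1 : ℕ) : ℕ∞) : ENNReal) : EReal) := by
        rw [ENat.toENNReal_coe, ← ENNReal.ofReal_natCast, EReal.coe_ennreal_ofReal,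
          max_eq_left (by positivity), Nat.cast_succ]
      _ ≤ ((N ω : ENNReal) : EReal) :=
        EReal.coe_ennreal_le_coe_ennreal_iff.2 (ENat.toENNReal_le.2 hN)
  have hunion := measureReal_union_le (μ := μ)
    {ω | (x : EReal) ≤ ((N ω : ENNReal) : EReal)} {ω | N ω ≤ t}
  rw [hcover, probReal_univ] at hunion
  linarith

/-- The leading term `log₂ log₂ n` of the lower bound. -/
noncomputable def doubleLog (n : ℕ) : ℝ := Real.logb 2 (Real.logb 2 (n : ℝ))

/-- The number of rounds, asymptotic to `log₂ log₂ n`, after which the process is shown to be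
unfinished with high probability. -/
noncomputable def roundCount (n : ℕ) : ℕ := ⌊doubleLog n - √(doubleLog n)⌋₊

/-- The relative error `δ(n)` in the lower bound. -/
noncomputable def relError (n : ℕ) : ℝ := -(√(doubleLog n))⁻¹

theorem tendsto_doubleLog : Tendsto doubleLog atTop atTop :=
  (Real.tendsto_logb_atTop one_lt_two).comp
    ((Real.tendsto_logb_atTop one_lt_two).comp tendsto_natCast_atTop_atTop)

theorem tendsto_relError : Tendsto relError atTop (𝓝 0) := by
  simpa only [neg_zero] using!
    (tendsto_inv_atTop_zero.comp (Real.tendsto_sqrt_atTop.comp tendsto_doubleLog)).neg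

theorem one_add_relError_mul_doubleLog_le (n : ℕ) :
    (1 + relError n) * doubleLog n ≤ roundCount n + 1 := by
  calc (1 + relError n) * doubleLog n = doubleLog n - √(doubleLog n) := by
        rw [relError, add_mul, neg_mul, inv_mul_eq_div, Real.div_sqrt]
        ring
    _ ≤ roundCount n + 1 := (Nat.lt_floor_add_one _).le

theorem roundCount_le_sub {n : ℕ} (h : 1 ≤ doubleLog n) :
    (roundCount n : ℝ) ≤ doubleLog n - √(doubleLog n) :=
  Nat.floor_le (sub_nonneg.2 (Real.sqrt_le_self_iff.2 (.inr h)))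

theorem logb_two_le_self {x : ℝ} (hx : 1 ≤ x) : Real.logb 2 x ≤ x := by
  rw [Real.logb_le_iff_le_rpow one_lt_two (by linarith)]
  have hbernoulli := one_add_mul_self_le_rpow_one_add (s := 1) (by norm_num) hx
  norm_num at hbernoulli
  linarith

theorem one_le_logb_two_natCast {n : ℕ} (hn : 2 ≤ n) : 1 ≤ Real.logb 2 n := by
  rw [Real.le_logb_iff_rpow_le one_lt_two (by positivity), Real.rpow_one]
  exact_mod_cast hn

theorem doubleLog_le_self {n : ℕ} (hn : 2 ≤ n) : doubleLog n ≤ n :=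
  (logb_two_le_self (one_le_logb_two_natCast hn)).trans
    (logb_two_le_self (by exact_mod_cast one_le_two.trans hn))

theorem eventually_four_add_le_two_rpow_sqrt : ∀ᶠ x : ℝ in atTop, 4 + x ≤ 2 ^ √x := by
  have hsq : ∀ᶠ y : ℝ in atTop, 4 + y ^ 2 ≤ 2 ^ y := by
    have ho := isLittleO_pow_exp_pos_mul_atTop 2 (Real.log_pos one_lt_two)
    filter_upwards [ho.bound (by norm_num : (0 : ℝ) < 1 / 2), eventually_ge_atTop 2] with y hy hy2
    rw [Real.norm_of_nonneg (by positivity), Real.norm_of_nonneg (Real.exp_pos _).le,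
      ← Real.rpow_def_of_pos two_pos] at hy
    nlinarith
  filter_upwards [Real.tendsto_sqrt_atTop.eventually hsq, eventually_ge_atTop 0] with x hx hx0
  rwa [Real.sq_sqrt hx0] at hx

theorem eventually_pow_roundCount_le :
    ∀ᶠ n : ℕ in atTop, (4 * (3 * Real.log n)) ^ 2 ^ roundCount n ≤ (n : ℝ) := by
  filter_upwards [eventually_ge_atTop 2, tendsto_doubleLog.eventually_ge_atTop 1,
    tendsto_doubleLog.eventually eventually_four_add_le_two_rpow_sqrt] with n hn hL hsqrt
  have hn0 : (0 : ℝ) < n := by positivity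
  have hlog : Real.logb 2 n = 2 ^ doubleLog n :=
    (Real.rpow_logb two_pos (by norm_num) (by linarith [one_le_logb_two_natCast hn])).symm
  have hbase : 4 * (3 * Real.log n) ≤ 2 ^ (4 + doubleLog n) := by
    have hlogb : Real.log n ≤ Real.logb 2 n :=
      le_div_self (Real.log_natCast_nonneg n) (Real.log_pos one_lt_two)
        (by linarith [Real.log_two_lt_d9])
    rw [Real.rpow_add two_pos, ← hlog]
    norm_num
    linarith [one_le_logb_two_natCast hn]
  have hexponent : (4 + doubleLog n) * 2 ^ roundCount n ≤ Real.logb 2 n := by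
    calc (4 + doubleLog n) * 2 ^ roundCount n
        ≤ 2 ^ √(doubleLog n) * 2 ^ (doubleLog n - √(doubleLog n)) := by
          rw [← Real.rpow_natCast 2 (roundCount n)]
          gcongr
          · exact one_le_two
          · exact roundCount_le_sub hL
      _ = Real.logb 2 n := by rw [← Real.rpow_add two_pos, add_sub_cancel, hlog]
  calc (4 * (3 * Real.log n)) ^ 2 ^ roundCount n
      ≤ (2 ^ (4 + doubleLog n)) ^ 2 ^ roundCount n := by
        gcongr
    _ = 2 ^ ((4 + doubleLog n) * 2 ^ roundCount n) := by
        rw [← Real.rpow_mul_natCast two_pos.le]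
        norm_cast
    _ ≤ 2 ^ Real.logb 2 n := Real.rpow_le_rpow_of_exponent_le one_le_two hexponent
    _ = n := Real.rpow_logb two_pos (by norm_num) hn0

theorem eventually_roundCount_mul_exp_le :
    ∀ᶠ n : ℕ in atTop, roundCount n * Real.exp (-(3 * Real.log n)) ≤ ((n : ℝ) ^ 2)⁻¹ := by
  filter_upwards [eventually_ge_atTop 2, tendsto_doubleLog.eventually_ge_atTop 1] with n hn hL
  have hn0 : (0 : ℝ) < n := by positivity
  have hexp : Real.exp (-(3 * Real.log n)) = ((n : ℝ) ^ 3)⁻¹ := by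
    rw [Real.exp_neg, mul_comm, Real.exp_mul, Real.exp_log hn0]
    norm_cast
  have hround : (roundCount n : ℝ) ≤ n := by
    linarith [roundCount_le_sub hL, doubleLog_le_self hn, Real.sqrt_nonneg (doubleLog n)]
  calc roundCount n * Real.exp (-(3 * Real.log n)) ≤ n * ((n : ℝ) ^ 3)⁻¹ := by
        rw [hexp]
        gcongr
    _ = ((n : ℝ) ^ 2)⁻¹ := by field_simp

theorem eventually_runMeasure_real_propTime_le_le :
    ∀ᶠ n : ℕ in atTop, ∀ (G : SimpleGraph (Fin n)) (v : Fin n),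
      (runMeasure (Fin n)).real {U | propTime G {v} U ≤ roundCount n} ≤ ((n : ℝ) ^ 2)⁻¹ := by
  have hlog : Tendsto (fun n : ℕ => 3 * Real.log n) atTop atTop :=
    (Real.tendsto_log_atTop.comp tendsto_natCast_atTop_atTop).const_mul_atTop three_pos
  filter_upwards [eventually_gt_atTop 0, hlog.eventually_ge_atTop 1, eventually_pow_roundCount_le,
    eventually_roundCount_mul_exp_le] with n hn hs hpow hfail G v
  have hn0 : (0 : ℝ) < n := by exact_mod_cast hn
  refine (runMeasure_real_propTime_le_le G hs (by simpa using hs) ?_).trans hfail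
  rw [Fintype.card_fin]
  linarith

instance [Countable V] : MeasurableSingletonClass (SimpleGraph V) where
  measurableSet_singleton G := by
    rw [← SimpleGraph.edgeSet_injective.preimage_image {G}, Set.image_singleton]
    exact SimpleGraph.measurable_edgeSet (measurableSet_singleton _)

theorem eventually_one_sub_le_measureReal_propTime :
    ∀ᶠ n : ℕ in atTop, ∀ (μ : Measure (SimpleGraph (Fin n))) [IsProbabilityMeasure μ] (v : Fin n),
      1 - ((n : ℝ) ^ 2)⁻¹ ≤ (μ.prod (runMeasure (Fin n))).real
        {x | (((1 + relError n) * doubleLog n : ℝ) : EReal) ≤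
          ((propTime x.1 {v} x.2 : ENNReal) : EReal)} := by
  filter_upwards [eventually_runMeasure_real_propTime_le_le] with n h μ _ v
  exact one_sub_le_measureReal_coe_le (one_add_relError_mul_doubleLog_le n)
    (measureReal_prod_le_of_forall_section_le fun G => h G v)

theorem eventually_one_sub_le_measureReal_graphPropTime :
    ∀ᶠ n : ℕ in atTop, ∀ (μ : Measure (SimpleGraph (Fin n))) [IsProbabilityMeasure μ],
      1 - (n : ℝ)⁻¹ ≤ (μ.prod (Measure.pi fun _ : Fin n => runMeasure (Fin n))).real
        {x | (((1 + relError n) * doubleLog n : ℝ) : EReal) ≤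
          ((graphPropTime x.1 x.2 : ENNReal) : EReal)} := by
  filter_upwards [eventually_runMeasure_real_propTime_le_le] with n h μ _
  refine one_sub_le_measureReal_coe_le (one_add_relError_mul_doubleLog_le n)
    (measureReal_prod_le_of_forall_section_le fun G => ?_)
  calc _ ≤ (n : ℝ) * ((n : ℝ) ^ 2)⁻¹ := by
        simpa using pi_runMeasure_real_graphPropTime_le_le G (h G)
    _ = (n : ℝ)⁻¹ := by field_simp

theorem isLittleO_inv_sq_natCast_inv :
    (fun n : ℕ => ((n : ℝ) ^ 2)⁻¹) =o[atTop] fun n : ℕ => (n : ℝ)⁻¹ := by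
  have h := (Asymptotics.isLittleO_pow_pow_atTop_of_lt (𝕜 := ℝ) one_lt_two).comp_tendsto
    (tendsto_natCast_atTop_atTop (R := ℝ))
  simp only [Function.comp_def, pow_one] at h
  exact h.inv_rev ((eventually_gt_atTop 0).mono fun n _ h0 => by simp_all)

end ProbZeroForcing

open ProbZeroForcing in
theorem theorem4p1_general :
    ∃ δ : ℕ → ℝ, Tendsto δ atTop (𝓝 0) ∧
      ∃ η : ℕ → ℝ, Asymptotics.IsLittleO atTop η (fun n : ℕ => ((n : ℝ))⁻¹) ∧
        ∀ (μ : ∀ n, Measure (SimpleGraph (Fin n))) [∀ n, IsProbabilityMeasure (μ n)],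
          (∀ (n : ℕ) (v : Fin n),
            1 - η n ≤ ((μ n).prod (runMeasure (Fin n))).real
              {x | (((1 + δ n) * Real.logb 2 (Real.logb 2 (n : ℝ)) : ℝ) : EReal) ≤
                ((propTime x.1 {v} x.2 : ENNReal) : EReal)}) ∧
          Tendsto (fun n : ℕ =>
            ((μ n).prod (Measure.pi fun _ : Fin n => runMeasure (Fin n))).real
              {x | (((1 + δ n) * Real.logb 2 (Real.logb 2 (n : ℝ)) : ℝ) : EReal) ≤
                ((graphPropTime x.1 x.2 : ENNReal) : EReal)})
            atTop (𝓝 1) := by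
  obtain ⟨N, hN⟩ := eventually_atTop.1 eventually_one_sub_le_measureReal_propTime
  have hη : (fun n : ℕ => ((n : ℝ) ^ 2)⁻¹) =ᶠ[atTop]
      fun n => if N ≤ n then ((n : ℝ) ^ 2)⁻¹ else 1 :=
    (eventually_ge_atTop N).mono fun n hn => (if_pos hn).symm
  refine ⟨relError, tendsto_relError, _, isLittleO_inv_sq_natCast_inv.congr' hη .rfl,
    fun μ _ => ⟨fun n v => ?_, ?_⟩⟩
  · split_ifs with hn
    · exact hN n hn (μ n) v
    · simp
  · refine tendsto_of_tendsto_of_tendsto_of_le_of_le'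
      (by simpa using tendsto_inv_atTop_nhds_zero_nat.const_sub (1 : ℝ)) tendsto_const_nhds
      ?_ (.of_forall fun n => measureReal_le_one)
    exact eventually_one_sub_le_measureReal_graphPropTime.mono fun n h => h (μ n)

theorem theorem4p1 (p : ℕ → unitInterval)
    (hp : ∀ᶠ n : ℕ in atTop, 1 / Real.log (n : ℝ) ^ 2 ≤ (p n : ℝ)) :
    ∃ δ : ℕ → ℝ, Tendsto δ atTop (𝓝 0) ∧
      (∃ η : ℕ → ℝ, Asymptotics.IsLittleO atTop η (fun n : ℕ => ((n : ℝ))⁻¹) ∧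
        ∀ (n : ℕ) (v : Fin n),
          1 - η n ≤ (ProbZeroForcing.oneRunMeasure n (p n)).real
            {x | (((1 + δ n) * Real.logb 2 (Real.logb 2 (n : ℝ)) : ℝ) : EReal) ≤
              ((ProbZeroForcing.propTime x.1 {v} x.2 : ENNReal) : EReal)}) ∧
      Tendsto (fun n : ℕ => (ProbZeroForcing.allRunsMeasure n (p n)).real
          {x | (((1 + δ n) * Real.logb 2 (Real.logb 2 (n : ℝ)) : ℝ) : EReal) ≤
            ((ProbZeroForcing.graphPropTime x.1 x.2 : ENNReal) : EReal)})
        atTop (𝓝 1) := by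
  obtain ⟨δ, hδ, η, hη, h⟩ := theorem4p1_general
  exact ⟨δ, hδ, ⟨η, hη, (h fun n => SimpleGraph.binomialRandom (Fin n) (p n)).1⟩, (h _).2⟩
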